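/- For a Boolean function $h\colon\{0,1\}^N\to\{0,1\}$, let $\widetilde{\deg}(h)$ denote its approximate degree, i.e. the least total degree of a real polynomial $p$ in $N$ variables with $|p(x)-h(x)|\le 1/3$ for all $x\in\{0,1\}^N$. For $f\colon\{0,1\}^n\to\{0,1\}$ and $g\colon\{0,1\}^m\to\{0,1\}$, let $f\circ g\colon\{0,1\}^{nm}\to\{0,1\}$ be the composed function $(f\circ g)(x_1,\dots,x_n)=f(g(x_1),\dots,g(x_n))$, where $x_i\in\{0,1\}^m$ for each $i$. Let $\mathsf{AND}_t$ and $\mathsf{OR}_m$ denote the AND function on $t$ bits and the OR function on $m$ bits. There are absolute constants $C>0$ and $c>0$ such that for all natural numbers $n$, $m$, every Boolean function $f\colon\{0,1\}^n\to\{0,1\}$, and every integer $t\ge 1$ with $t\ge C\log n$ (for $n=0$ the latter condition is void), \[ \widetilde{\deg}(f\circ\mathsf{AND}_t\circ\mathsf{OR}_m)\;\ge\; c\cdot\widetilde{\deg}(f)\cdot\widetilde{\deg}(\mathsf{OR}_m). \] -/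

import Mathlib

/-- Boolean functions `{0,1}^ι → {0,1}` on input bits indexed by `ι`. -/
abbrev BoolFn (ι : Type) : Type := (ι → Bool) → Bool

namespace BoolFn

/-- A bit, viewed as the real number `0` or `1`. -/
def bit (b : Bool) : ℝ := if b then 1 else 0

/-- The composition `f ∘ g`: input bits are doubly indexed, `x = (x_{ij})`, and
`(f ∘ g)(x) = f(g(x_1), …, g(x_n))` where `x_i = (x_{i1}, …, x_{im})`. -/
def comp {ι κ : Type} (f : BoolFn ι) (g : BoolFn κ) : BoolFn (ι × κ) :=
  fun x => f (fun i => g (fun j => x (i, j)))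

/-- The `AND` function on `t` bits. -/
def AND (t : ℕ) : BoolFn (Fin t) := fun x => decide (∀ i, x i = true)

/-- The `OR` function on `m` bits. -/
def OR (m : ℕ) : BoolFn (Fin m) := fun x => decide (∃ i, x i = true)

/-- The real polynomial `p` approximates `f` to within `ε` at every point of the cube. -/
def Approximates {ι : Type} (ε : ℝ) (p : MvPolynomial ι ℝ) (f : BoolFn ι) : Prop :=
  ∀ x : ι → Bool, |MvPolynomial.eval (fun i => bit (x i)) p - bit (f x)| ≤ ε

/-- The `ε`-approximate degree: the least total degree of a real polynomial that
`ε`-approximates `f`. -/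
noncomputable def approxDegree {ι : Type} (ε : ℝ) (f : BoolFn ι) : ℕ :=
  sInf {d : ℕ | ∃ p : MvPolynomial ι ℝ, Approximates ε p f ∧ p.totalDegree = d}

/-- The approximate degree, with the conventional error `1/3`. -/
noncomputable def adeg {ι : Type} (f : BoolFn ι) : ℕ := approxDegree (1 / 3) f

end BoolFn

/-!
The proof averages an approximating polynomial over product distributions.

By finite-dimensional separation (`exists_weights_OR`), if `OR_m` has no good approximation of
degree `k * e`, there are two probability weights `ν₀`, `ν₁` on `{0,1}^m` with the same moments of
degree at most `e`, such that `ν₁` lives on `OR_m = 1` and `ν₀` gives mass at most `ε` to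
`OR_m = 1`. The error is one-sided, so passing to `t`-fold products keeps `ν₁` exact and lowers
the error of `ν₀` with respect to `AND_t ∘ OR_m` to `ε ^ t` (`sum_blockWeight_AND_OR_le`), while
moments of degree at most `e` still agree (`MomentsAgree.blockWeight`).

Let `p` approximate `f ∘ g`, where `g = AND_t ∘ OR_m`, and for a bit string `b` let `q(b)` be the
expectation of `p` when the `i`-th block is drawn independently from the weight belonging to `b_i`.
A block contributes to the dependence on `b` only if a monomial of `p` has degree at least `e + 1`
in it, and then only linearly. Hence `q` is a polynomial with `deg q * (e + 1) ≤ deg p`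
(`exists_average_polynomial`). Since `n * ε ^ t` is small, a union bound shows that `q` approximates
`f` with error only slightly above `1/3` (`approximates_of_average`), and a cubic univariate
polynomial brings this back to `1/3` (`adeg_le_three_mul_of_approximates`). The upper bound on
`adeg (OR_m)` in terms of `e` finishes the argument; its order of growth is never used.
-/

namespace BoolFn

open Finset MvPolynomial

/-! ### Bits and polynomials on the cube -/

lemma bit_pow (b : Bool) {k : ℕ} (hk : k ≠ 0) : bit b ^ k = bit b := by
  cases b <;> simp [bit, hk]

lemma abs_bit_sub_bit_le_one (a b : Bool) : |bit a - bit b| ≤ 1 := by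
  cases a <;> cases b <;> simp [bit]

/-- The multilinear monomial `∏_{i ∈ S} x_i` as a function on the cube. -/
def cubeMonomial {ι : Type} (S : Finset ι) (x : ι → Bool) : ℝ := ∏ i ∈ S, bit (x i)

/-- On the cube only the multilinear reduction of a polynomial matters. -/
lemma eval_bit_eq_sum_cubeMonomial {ι : Type} (p : MvPolynomial ι ℝ) (x : ι → Bool) :
    eval (fun i => bit (x i)) p = ∑ s ∈ p.support, p.coeff s * cubeMonomial s.support x := by
  rw [eval_eq]
  refine sum_congr rfl fun s _ => ?_
  congr 1
  exact prod_congr rfl fun i hi => bit_pow _ (Finsupp.mem_support_iff.mp hi)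

lemma card_support_le_totalDegree {ι : Type} {p : MvPolynomial ι ℝ} {s : ι →₀ ℕ}
    (hs : s ∈ p.support) : s.support.card ≤ p.totalDegree := by
  refine le_trans ?_ (le_totalDegree hs)
  rw [Finsupp.sum, card_eq_sum_ones]
  exact sum_le_sum fun i hi => Nat.one_le_iff_ne_zero.mpr (Finsupp.mem_support_iff.mp hi)

/-- Interpolation: the real polynomial that agrees with `f` on the cube shows that the infimum
defining `approxDegree` is attained. -/
lemma exists_approximates_totalDegree_eq_adeg {ι : Type} [Fintype ι] (f : BoolFn ι) :
    ∃ p : MvPolynomial ι ℝ, Approximates (1 / 3) p f ∧ p.totalDegree = adeg f := by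
  classical
  refine Nat.sInf_mem (s := {d : ℕ | ∃ p : MvPolynomial ι ℝ,
    Approximates (1 / 3) p f ∧ p.totalDegree = d}) ⟨_, ∑ a : ι → Bool, C (bit (f a)) *
    ∏ i, (if a i then X i else 1 - X i), fun x => ?_, rfl⟩
  have key (a : ι → Bool) :
      (∏ i, if a i then bit (x i) else 1 - bit (x i)) = if a = x then (1 : ℝ) else 0 := by
    split_ifs with h
    · subst h
      exact prod_eq_one fun i _ => by cases a i <;> simp [bit]
    · obtain ⟨i, hi⟩ := Function.ne_iff.mp h
      refine prod_eq_zero (mem_univ i) ?_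
      revert hi
      cases a i <;> cases x i <;> simp [bit]
  have h : eval (fun i => bit (x i)) (∑ a : ι → Bool, C (bit (f a)) *
      ∏ i, (if a i then X i else 1 - X i)) = bit (f x) := by
    simp only [map_sum, map_mul, eval_C, map_prod, apply_ite (eval _), eval_X, map_sub, map_one,
      key]
    simp
  rw [h]
  norm_num

lemma adeg_le_of_approximates {ι : Type} {f : BoolFn ι} {p : MvPolynomial ι ℝ}
    (h : Approximates (1 / 3) p f) : adeg f ≤ p.totalDegree :=
  Nat.sInf_le ⟨p, h, rfl⟩

lemma abs_cubic_le {s : ℝ} (hs : |s| ≤ 1 / 3 + 1 / 100) :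
    |1 / 2 + 7 / 5 * (s - 1 / 2) - (s - 1 / 2) ^ 3| ≤ 1 / 3 := by
  have h2 : s ^ 2 ≤ (1 / 3 + 1 / 100) ^ 2 := sq_le_sq' (abs_le.mp hs).1 (abs_le.mp hs).2
  have hexp : 1 / 2 + 7 / 5 * (s - 1 / 2) - (s - 1 / 2) ^ 3 =
      -(s * s ^ 2) + 3 / 2 * s ^ 2 + 13 / 20 * s - 3 / 40 := by ring
  obtain ⟨hl, hr⟩ := abs_le.mp hs
  rw [hexp, abs_le]
  have h0 := sq_nonneg s
  rcases le_total 0 s with h | h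
  · have h3 := mul_nonneg h h0
    have h4 : s * s ^ 2 ≤ (1 / 3 + 1 / 100) * (1 / 3 + 1 / 100) ^ 2 :=
      mul_le_mul hr h2 h0 (by norm_num)
    constructor <;> linarith
  · have h3 := mul_nonneg (neg_nonneg.2 h) h0
    have h4 : -s * s ^ 2 ≤ (1 / 3 + 1 / 100) * (1 / 3 + 1 / 100) ^ 2 :=
      mul_le_mul (by linarith) h2 h0 (by norm_num)
    constructor <;> linarith

/-- The cubic `u ↦ (7/5) u - u ^ 3`, centred at `1/2`, maps the interval `[13/100, 87/100]` into
`[1/6, 5/6]`; being odd, it lowers an error slightly above `1/3` to `1/3` on both sides. -/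
lemma adeg_le_three_mul_of_approximates {ι : Type} {f : BoolFn ι} {q : MvPolynomial ι ℝ}
    (h : Approximates (1 / 3 + 1 / 100) q f) : adeg f ≤ 3 * q.totalDegree := by
  set u : MvPolynomial ι ℝ := q - C (1 / 2) with hu
  have hud : u.totalDegree ≤ q.totalDegree := by
    refine (totalDegree_sub _ _).trans ?_
    simp
  refine (adeg_le_of_approximates (p := C (1 / 2) + C (7 / 5) * u - u ^ 3) ?_).trans ?_
  · intro x
    have hx := h x
    simp only [hu, map_sub, map_add, map_mul, map_pow, eval_C]
    set s := eval (fun i => bit (x i)) q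
    cases hf : f x <;> simp only [hf, bit, if_true, Bool.false_eq_true, if_false] at hx ⊢
    · rw [sub_zero] at hx ⊢
      exact abs_cubic_le hx
    · rw [abs_sub_comm] at hx ⊢
      refine le_of_eq_of_le (congrArg _ ?_) (abs_cubic_le hx)
      ring
  · refine (totalDegree_sub _ _).trans (max_le ((totalDegree_add _ _).trans (max_le ?_ ?_)) ?_)
    · simp
    · refine (totalDegree_mul _ _).trans ?_
      simp only [totalDegree_C]
      omega
    · exact (totalDegree_pow _ _).trans (by omega)

/-! ### Product weights on blocks -/

/-- The product of the weights `w i`, where `w i` governs the `i`-th block of the input. -/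
def blockWeight {ι κ : Type} [Fintype ι] (w : ι → (κ → Bool) → ℝ) (x : ι × κ → Bool) : ℝ :=
  ∏ i, w i fun j => x (i, j)

section Blocks

variable {ι κ : Type} [Fintype ι] [DecidableEq ι] [Fintype κ] [DecidableEq κ]

lemma sum_blockWeight_mul_prod (w h : ι → (κ → Bool) → ℝ) :
    ∑ x, blockWeight w x * ∏ i, h i (fun j => x (i, j)) = ∏ i, ∑ y, w i y * h i y := by
  rw [prod_univ_sum, Fintype.piFinset_univ]
  refine Fintype.sum_equiv (Equiv.curry ι κ Bool) _ _ fun x => ?_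
  rw [blockWeight, ← prod_mul_distrib]
  rfl

lemma blockWeight_mem_stdSimplex {w : ι → (κ → Bool) → ℝ}
    (hw : ∀ i, w i ∈ stdSimplex ℝ (κ → Bool)) :
    blockWeight w ∈ stdSimplex ℝ (ι × κ → Bool) := by
  refine ⟨fun x => prod_nonneg fun i _ => (hw i).1 _, ?_⟩
  simpa [(hw _).2] using sum_blockWeight_mul_prod w fun _ _ => 1

lemma sum_blockWeight_mul_marginal {w : ι → (κ → Bool) → ℝ}
    (hw : ∀ i, w i ∈ stdSimplex ℝ (κ → Bool)) (i : ι) (h : (κ → Bool) → ℝ) :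
    ∑ x, blockWeight w x * h (fun j => x (i, j)) = ∑ y, w i y * h y := by
  have key := sum_blockWeight_mul_prod w fun i' y => if i' = i then h y else 1
  simp only [prod_ite_eq', mem_univ, if_true] at key
  rw [key, prod_eq_single i]
  · simp
  · intro i' _ hi'
    simpa [hi'] using (hw i').2
  · simp

/-- The part of `S` in the `i`-th block. -/
def blockPart (S : Finset (ι × κ)) (i : ι) : Finset κ := univ.filter fun j => (i, j) ∈ S

lemma sum_card_blockPart (S : Finset (ι × κ)) : ∑ i, (blockPart S i).card = S.card := by
  simp only [blockPart, card_filter]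
  rw [← Fintype.sum_prod_type' (f := fun i j => if (i, j) ∈ S then 1 else 0)]
  simp

lemma card_blockPart_le (S : Finset (ι × κ)) (i : ι) : (blockPart S i).card ≤ S.card :=
  (single_le_sum (f := fun i => (blockPart S i).card) (fun _ _ => Nat.zero_le _)
    (mem_univ i)).trans (sum_card_blockPart S).le

lemma cubeMonomial_eq_prod_blockPart (S : Finset (ι × κ)) (x : ι × κ → Bool) :
    cubeMonomial S x = ∏ i, cubeMonomial (blockPart S i) (fun j => x (i, j)) := by
  simp only [cubeMonomial, blockPart, prod_filter]
  rw [← Fintype.prod_prod_type' (f := fun i j => if (i, j) ∈ S then bit (x (i, j)) else 1)]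
  simp

lemma sum_blockWeight_mul_cubeMonomial (w : ι → (κ → Bool) → ℝ) (S : Finset (ι × κ)) :
    ∑ x, blockWeight w x * cubeMonomial S x =
      ∏ i, ∑ y, w i y * cubeMonomial (blockPart S i) y := by
  simp only [cubeMonomial_eq_prod_blockPart S]
  exact sum_blockWeight_mul_prod w fun i y => cubeMonomial (blockPart S i) y

/-- The weights `w false` and `w true` have the same moments of degree at most `e`. -/
def MomentsAgree (e : ℕ) (w : Bool → (κ → Bool) → ℝ) : Prop :=
  ∀ S : Finset κ, S.card ≤ e →
    ∑ y, w false y * cubeMonomial S y = ∑ y, w true y * cubeMonomial S y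

lemma MomentsAgree.blockWeight {e : ℕ} {w : Bool → (κ → Bool) → ℝ} (h : MomentsAgree e w) :
    MomentsAgree e fun b => blockWeight fun _ : ι => w b := by
  intro S hS
  simp only [sum_blockWeight_mul_cubeMonomial]
  exact prod_congr rfl fun i _ => h _ ((card_blockPart_le S i).trans hS)

/-! ### Averaging over blocks -/

/-- Averaging a monomial over blocks drawn according to `b` gives a product over the blocks. Blocks
in which the monomial has degree at most `e` contribute constants, the others affine functions of
`b i`; each of the latter uses up `e + 1` of the degree of the monomial. -/
lemma exists_average_cubeMonomial {e : ℕ} {w : Bool → (κ → Bool) → ℝ} (h : MomentsAgree e w)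
    (S : Finset (ι × κ)) :
    ∃ q : MvPolynomial ι ℝ, q.totalDegree * (e + 1) ≤ S.card ∧ ∀ b : ι → Bool,
      eval (fun i => bit (b i)) q =
        ∑ x, blockWeight (fun i => w (b i)) x * cubeMonomial S x := by
  set M : Bool → ι → ℝ := fun a i => ∑ y, w a y * cubeMonomial (blockPart S i) y with hM
  set r : ι → MvPolynomial ι ℝ := fun i =>
    if (blockPart S i).card ≤ e then C (M false i)
    else C (M false i) + C (M true i - M false i) * X i with hr
  refine ⟨∏ i, r i, ?_, fun b => ?_⟩
  · calc (∏ i, r i).totalDegree * (e + 1) ≤ (∑ i, (r i).totalDegree) * (e + 1) :=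
          Nat.mul_le_mul_right _ (totalDegree_finsetProd _ _)
      _ = ∑ i, (r i).totalDegree * (e + 1) := sum_mul _ _ _
      _ ≤ ∑ i, (blockPart S i).card := sum_le_sum fun i _ => ?_
      _ = S.card := sum_card_blockPart S
    simp only [hr]
    split_ifs with hi
    · simp
    · have : (C (M false i) + C (M true i - M false i) * X i :
          MvPolynomial ι ℝ).totalDegree ≤ 1 := by
        refine (totalDegree_add _ _).trans (max_le (by simp) ((totalDegree_mul _ _).trans ?_))
        rw [totalDegree_C, totalDegree_X]
      nlinarith
  · rw [sum_blockWeight_mul_cubeMonomial, map_prod]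
    refine prod_congr rfl fun i _ => ?_
    simp only [hr]
    split_ifs with hi
    · have := h _ hi
      cases b i <;> simp [hM, this]
    · cases hb : b i <;> simp [hM, hb, bit]

lemma exists_average_polynomial {e : ℕ} {w : Bool → (κ → Bool) → ℝ} (h : MomentsAgree e w)
    (p : MvPolynomial (ι × κ) ℝ) :
    ∃ q : MvPolynomial ι ℝ, q.totalDegree * (e + 1) ≤ p.totalDegree ∧ ∀ b : ι → Bool,
      eval (fun i => bit (b i)) q =
        ∑ x, blockWeight (fun i => w (b i)) x * eval (fun ij => bit (x ij)) p := by
  choose Q hQd hQ using exists_average_cubeMonomial (ι := ι) h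
  refine ⟨∑ s ∈ p.support, C (p.coeff s) * Q s.support, ?_, fun b => ?_⟩
  · rw [← Nat.le_div_iff_mul_le e.succ_pos]
    refine totalDegree_finsetSum_le fun s hs => ?_
    refine (totalDegree_mul _ _).trans ?_
    rw [totalDegree_C, zero_add, Nat.le_div_iff_mul_le e.succ_pos]
    exact (hQd _).trans (card_support_le_totalDegree hs)
  · simp only [map_sum, map_mul, eval_C, hQ, eval_bit_eq_sum_cubeMonomial, mul_sum]
    rw [sum_comm]
    exact sum_congr rfl fun x _ => sum_congr rfl fun s _ => by ring

/-- If drawing a block from `w a` fails to give `g = a` with probability at most `η`, then by a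
union bound, drawing all blocks according to `b` yields an input of `f ∘ g` with value `f b`
except with probability at most `η` times the number of blocks. -/
lemma approximates_of_average {f : BoolFn ι} {g : BoolFn κ} {ε η : ℝ}
    {w : Bool → (κ → Bool) → ℝ} (hw : ∀ a, w a ∈ stdSimplex ℝ (κ → Bool))
    (hη : ∀ a, ∑ y, w a y * (if g y = a then 0 else 1) ≤ η)
    {p : MvPolynomial (ι × κ) ℝ} (hp : Approximates ε p (comp f g)) {q : MvPolynomial ι ℝ}
    (hq : ∀ b : ι → Bool, eval (fun i => bit (b i)) q =
      ∑ x, blockWeight (fun i => w (b i)) x * eval (fun ij => bit (x ij)) p) :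
    Approximates (ε + Fintype.card ι * η) q f := by
  intro b
  have hW := blockWeight_mem_stdSimplex (w := fun i => w (b i)) fun i => hw (b i)
  set W := blockWeight fun i => w (b i) with hWdef
  have hfail (x : ι × κ → Bool) : |bit (comp f g x) - bit (f b)| ≤
      ∑ i, if g (fun j => x (i, j)) = b i then (0 : ℝ) else 1 := by
    by_cases hx : ∀ i, g (fun j => x (i, j)) = b i
    · have : comp f g x = f b := congrArg f (funext hx)
      simp [this, hx]
    · push Not at hx
      obtain ⟨i, hi⟩ := hx
      refine (abs_bit_sub_bit_le_one _ _).trans ?_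
      refine le_trans (by simp [hi]) (single_le_sum (fun i _ => ?_) (mem_univ i))
      split_ifs <;> norm_num
  have hpoint (x : ι × κ → Bool) : |eval (fun ij => bit (x ij)) p - bit (f b)| ≤
      ε + ∑ i, if g (fun j => x (i, j)) = b i then (0 : ℝ) else 1 :=
    (abs_sub_le _ (bit (comp f g x)) _).trans (add_le_add (hp x) (hfail x))
  calc |eval (fun i => bit (b i)) q - bit (f b)|
      = |∑ x, W x * (eval (fun ij => bit (x ij)) p - bit (f b))| := by
        rw [hq, ← hWdef]
        simp only [mul_sub, sum_sub_distrib, ← sum_mul, hW.2, one_mul]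
    _ ≤ ∑ x, |W x * (eval (fun ij => bit (x ij)) p - bit (f b))| := abs_sum_le_sum_abs _ _
    _ ≤ ∑ x, W x * (ε + ∑ i, if g (fun j => x (i, j)) = b i then (0 : ℝ) else 1) := by
        refine sum_le_sum fun x _ => ?_
        rw [abs_mul, abs_of_nonneg (hW.1 x)]
        exact mul_le_mul_of_nonneg_left (hpoint x) (hW.1 x)
    _ = ε + ∑ i, ∑ x, W x * (if g (fun j => x (i, j)) = b i then (0 : ℝ) else 1) := by
        simp only [mul_add, sum_add_distrib, ← sum_mul, hW.2, one_mul, mul_sum]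
        rw [sum_comm]
    _ ≤ ε + ∑ _i : ι, η := by
        gcongr with i
        rw [hWdef, sum_blockWeight_mul_marginal (w := fun i => w (b i)) (fun i => hw (b i)) i
          fun y => if g y = b i then (0 : ℝ) else 1]
        exact hη (b i)
    _ = ε + Fintype.card ι * η := by simp

end Blocks

/-! ### Weights witnessing the hardness of the OR function -/

lemma OR_eq_false_iff {m : ℕ} {y : Fin m → Bool} : OR m y = false ↔ y = fun _ => false := by
  simp [OR, funext_iff]

/-- A polynomial whose values at nonzero points lie more than a fraction `ε` of the way from its
value at `0` to its maximum yields an approximation of `OR` of degree `k` times its own. -/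
lemma adeg_OR_le_of_separates {m k : ℕ} {ε : ℝ} (hk : (1 - ε) ^ k ≤ 1 / 3)
    (h : MvPolynomial (Fin m) ℝ)
    (hsep : ∀ y z : Fin m → Bool, OR m y = true →
      (1 - ε) * eval (fun _ => bit false) h + ε * eval (fun i => bit (z i)) h <
        eval (fun i => bit (y i)) h) :
    adeg (OR m) ≤ k * h.totalDegree := by
  by_cases hm : ∃ y, OR m y = true
  · obtain ⟨y₀, hy₀⟩ := hm
    obtain ⟨z, -, hz⟩ := exists_max_image univ
      (fun z : Fin m → Bool => eval (fun i => bit (z i)) h) univ_nonempty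
    set H : (Fin m → Bool) → ℝ := fun z => eval (fun i => bit (z i)) h with hH
    set H₀ : ℝ := eval (fun _ => bit false) h with hH₀
    have hpos : 0 < H z - H₀ := by
      have h1 := hsep y₀ (fun _ => false) hy₀
      have h2 := hz y₀ (mem_univ _)
      have h3 : H y₀ ≤ H z := h2
      have h4 : (1 - ε) * H₀ + ε * H₀ < H y₀ := h1
      linarith
    -- The normalised polynomial is `1` at `0` and lies in `[0, 1 - ε]` elsewhere.
    set u : MvPolynomial (Fin m) ℝ := C (H z - H₀)⁻¹ * (C (H z) - h) with hu
    refine (adeg_le_of_approximates (p := 1 - u ^ k) fun y => ?_).trans ?_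
    · have huy : eval (fun i => bit (y i)) u = (H z - H y) / (H z - H₀) := by
        simp only [hu, map_mul, map_sub, eval_C, hH]
        rw [inv_mul_eq_div]
      simp only [map_sub, map_one, map_pow, huy]
      cases hy : OR m y
      · have : H y = H₀ := by rw [OR_eq_false_iff.mp hy]
        rw [this, div_self hpos.ne']
        norm_num [bit]
      · have h0 : 0 ≤ (H z - H y) / (H z - H₀) :=
          div_nonneg (sub_nonneg.2 (hz y (mem_univ _))) hpos.le
        have h1 : (H z - H y) / (H z - H₀) ≤ 1 - ε := by
          rw [div_le_iff₀ hpos]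
          have h2 : (1 - ε) * H₀ + ε * H z < H y := hsep y z hy
          linarith
        have h2 := (pow_le_pow_left₀ h0 h1 k).trans hk
        have h3 := pow_nonneg h0 k
        simp only [bit, if_true]
        rw [abs_le]
        constructor <;> linarith
    · refine (totalDegree_sub _ _).trans (max_le (by simp) ((totalDegree_pow _ _).trans ?_))
      refine Nat.mul_le_mul_left k ((totalDegree_mul _ _).trans ?_)
      rw [totalDegree_C, zero_add]
      exact (totalDegree_sub _ _).trans (by simp)
  · push Not at hm
    refine (adeg_le_of_approximates (p := 0) fun y => ?_).trans (by simp)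
    have : OR m y = false := by simpa using hm y
    simp [this, bit]

/-- Linear programming duality for one-sided approximation of `OR`. If the moment vectors of
`δ_y - (1 - ε) δ_0 - ε δ_z`, with `y` nonzero, do not have `0` in their convex hull, a separating
functional is a polynomial of degree at most `e` as in `adeg_OR_le_of_separates`. -/
lemma exists_weights_OR {m k e : ℕ} {ε : ℝ} (hε : 0 < ε) (hε1 : ε ≤ 1)
    (hk : (1 - ε) ^ k ≤ 1 / 3) (he : k * e < adeg (OR m)) :
    ∃ ν : Bool → (Fin m → Bool) → ℝ, (∀ a, ν a ∈ stdSimplex ℝ (Fin m → Bool)) ∧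
      MomentsAgree e ν ∧ (∀ y, OR m y = false → ν true y = 0) ∧
      ∑ y, ν false y * (if OR m y = false then 0 else 1) ≤ ε := by
  set o : Fin m → Bool := fun _ => false
  let J := {y : Fin m → Bool // OR m y = true} × (Fin m → Bool)
  let I := {S : Finset (Fin m) // S.card ≤ e}
  let v : J → I → ℝ := fun j S => cubeMonomial S.1 j.1.1 -
    ((1 - ε) * cubeMonomial S.1 o + ε * cubeMonomial S.1 j.2)
  by_cases h0 : (0 : I → ℝ) ∈ convexHull ℝ (Set.range v)
  · obtain ⟨K, _, l, z, hl0, hl1, hz, hl⟩ := mem_convexHull_iff_exists_fintype.mp h0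
    choose j hj using hz
    let ν : Bool → (Fin m → Bool) → ℝ := fun a y =>
      if a then ∑ i, l i * (if y = (j i).1.1 then 1 else 0)
      else (1 - ε) * (if y = o then 1 else 0) + ε * ∑ i, l i * (if y = (j i).2 then 1 else 0)
    have hswap (F : (Fin m → Bool) → ℝ) (r : K → Fin m → Bool) :
        ∑ y, (∑ i, l i * (if y = r i then 1 else 0)) * F y = ∑ i, l i * F (r i) := by
      simp only [sum_mul]
      rw [sum_comm]
      refine sum_congr rfl fun i _ => ?_
      simp
    have htrue (F : (Fin m → Bool) → ℝ) : ∑ y, ν true y * F y = ∑ i, l i * F (j i).1.1 :=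
      hswap F fun i => (j i).1.1
    have hfalse (F : (Fin m → Bool) → ℝ) :
        ∑ y, ν false y * F y = (1 - ε) * F o + ε * ∑ i, l i * F (j i).2 := by
      rw [← hswap F fun i => (j i).2, mul_sum]
      simp [ν, add_mul, sum_add_distrib, mul_assoc]
    refine ⟨ν, fun a => ⟨fun y => ?_, ?_⟩, fun S hS => ?_, fun y hy => ?_, ?_⟩
    · have hnn (r : K → Fin m → Bool) : 0 ≤ ∑ i, l i * (if y = r i then (1 : ℝ) else 0) :=
        sum_nonneg fun i _ => mul_nonneg (hl0 i) (by split_ifs <;> norm_num)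
      cases a
      · exact add_nonneg (mul_nonneg (by linarith) (by split_ifs <;> norm_num))
          (mul_nonneg hε.le (hnn _))
      · exact hnn _
    · cases a
      · simpa [hl1] using hfalse fun _ => 1
      · simpa [hl1] using htrue fun _ => 1
    · rw [htrue, hfalse]
      have hcoord := congrFun hl ⟨S, hS⟩
      simp only [← hj, v, Finset.sum_apply, Pi.smul_apply, smul_eq_mul, Pi.zero_apply, mul_sub,
        mul_add, sum_sub_distrib, sum_add_distrib, ← sum_mul, hl1, one_mul] at hcoord
      rw [mul_sum]
      simp only [mul_left_comm ε]
      linarith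
    · refine sum_eq_zero fun i _ => ?_
      rw [if_neg, mul_zero]
      rintro rfl
      rw [(j i).1.2] at hy
      exact absurd hy (by simp)
    · rw [hfalse, if_pos (OR_eq_false_iff.mpr rfl), mul_zero, zero_add]
      refine mul_le_of_le_one_right hε.le ((sum_le_sum fun i _ => ?_).trans hl1.le)
      exact mul_le_of_le_one_right (hl0 i) (by split_ifs <;> norm_num)
  · exfalso
    obtain ⟨φ, u, hu0, hu⟩ := geometric_hahn_banach_point_closed (convex_convexHull ℝ _)
      ((Set.finite_range v).isClosed_convexHull ℝ) h0
    rw [map_zero] at hu0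
    set h : MvPolynomial (Fin m) ℝ :=
      ∑ S : I, C (φ (Pi.single S 1)) * ∏ i ∈ S.1, X i with hh
    have heval (y : Fin m → Bool) :
        eval (fun i => bit (y i)) h = φ fun S => cubeMonomial S.1 y := by
      rw [← ContinuousLinearMap.coe_coe, LinearMap.pi_apply_eq_sum_univ φ.toLinearMap]
      have hsingle (S : I) : (Pi.single S 1 : I → ℝ) = fun S' => if S = S' then 1 else 0 := by
        funext S'
        simp [Pi.single_apply, eq_comm]
      simp [hh, cubeMonomial, mul_comm, hsingle]
    have hdeg : h.totalDegree ≤ e := by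
      refine totalDegree_finsetSum_le fun S _ => (totalDegree_mul _ _).trans ?_
      rw [totalDegree_C, zero_add]
      refine (totalDegree_finsetProd _ _).trans ?_
      simpa using S.2
    refine absurd ((adeg_OR_le_of_separates hk h fun y z hy => ?_).trans
      (Nat.mul_le_mul_left k hdeg)) (not_le.mpr he)
    have hpos := hu0.trans (hu _ (subset_convexHull ℝ _ ⟨(⟨y, hy⟩, z), rfl⟩))
    have hv : v (⟨y, hy⟩, z) = (fun S : I => cubeMonomial S.1 y) -
        ((1 - ε) • (fun S : I => cubeMonomial S.1 o) +
          ε • fun S : I => cubeMonomial S.1 z) := rfl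
    rw [hv, map_sub, map_add, map_smul, map_smul, ← heval, ← heval, ← heval, smul_eq_mul,
      smul_eq_mul] at hpos
    exact sub_pos.mp hpos

/-- Since `ν true` is exact, so is its product. Under the product of `ν false`, the function
`AND_t ∘ OR_m` is `1` only if all `t` independent blocks err. -/
lemma sum_blockWeight_AND_OR_le {m t : ℕ} {ε : ℝ} {ν : Bool → (Fin m → Bool) → ℝ}
    (hν : ∀ a, ν a ∈ stdSimplex ℝ (Fin m → Bool)) (h1 : ∀ y, OR m y = false → ν true y = 0)
    (h0 : ∑ y, ν false y * (if OR m y = false then 0 else 1) ≤ ε) (a : Bool) :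
    ∑ x, blockWeight (fun _ : Fin t => ν a) x *
      (if comp (AND t) (OR m) x = a then 0 else 1) ≤ ε ^ t := by
  have hn : 0 ≤ ∑ y, ν false y * (if OR m y = false then (0 : ℝ) else 1) :=
    sum_nonneg fun y _ => mul_nonneg ((hν _).1 y) (by split_ifs <;> norm_num)
  cases a
  · refine le_trans (le_of_eq ?_) (pow_le_pow_left₀ hn h0 t)
    have key := sum_blockWeight_mul_prod (fun _ : Fin t => ν false)
      fun _ y => if OR m y = false then (0 : ℝ) else 1
    rw [prod_const, card_univ, Fintype.card_fin] at key
    rw [← key]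
    refine sum_congr rfl fun x _ => ?_
    congr 1
    by_cases hx : ∀ i : Fin t, OR m (fun j => x (i, j)) = true
    · simp [comp, AND, hx]
    · have : comp (AND t) (OR m) x = false := by simpa [comp, AND] using hx
      rw [if_pos this]
      push Not at hx
      obtain ⟨i, hi⟩ := hx
      exact (prod_eq_zero (mem_univ i) (by simp [hi])).symm
  · refine le_trans (le_of_eq (sum_eq_zero fun x _ => ?_)) (pow_nonneg (hn.trans h0) t)
    split_ifs with hx
    · simp
    · have : ∃ i : Fin t, OR m (fun j => x (i, j)) = false := by
        simpa [comp, AND] using hx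
      obtain ⟨i, hi⟩ := this
      rw [blockWeight, prod_eq_zero (mem_univ i) (h1 _ hi), zero_mul]

end BoolFn

theorem mainTheorem8 :
    ∃ C : ℝ, 0 < C ∧ ∃ c : ℝ, 0 < c ∧
      ∀ (n t m : ℕ) (f : BoolFn (Fin n)), 1 ≤ t → C * Real.log (n : ℝ) ≤ (t : ℝ) →
        c * ((BoolFn.adeg f : ℝ) * (BoolFn.adeg (BoolFn.OR m) : ℝ)) ≤
          (BoolFn.adeg (BoolFn.comp f (BoolFn.comp (BoolFn.AND t) (BoolFn.OR m))) : ℝ) := by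
  obtain ⟨k, hk⟩ := exists_pow_lt_of_lt_one (show (0 : ℝ) < 1 / 3 by norm_num)
    (show (1 - 1 / 10000 : ℝ) < 1 by norm_num)
  have hk0 : 0 < k := by
    rcases Nat.eq_zero_or_pos k with rfl | h
    · norm_num at hk
    · exact h
  refine ⟨1, one_pos, 1 / (3 * k), by positivity, fun n t m f ht hnt => ?_⟩
  rcases Nat.eq_zero_or_pos (BoolFn.adeg (BoolFn.OR m)) with hOR | hOR
  · simp [hOR]
  set A := BoolFn.adeg (BoolFn.OR m) with hA
  -- The largest `e` with `k * e < A`.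
  set e := (A - 1) / k with he
  have he1 : k * e < A := by
    have := Nat.mul_div_le (A - 1) k
    rw [← he] at this
    omega
  have he2 : A ≤ k * (e + 1) := by
    have := Nat.lt_mul_div_succ (A - 1) hk0
    rw [← he] at this
    omega
  obtain ⟨ν, hν, hmom, h1, h0⟩ :=
    BoolFn.exists_weights_OR (by norm_num) (by norm_num) hk.le he1
  obtain ⟨p, hp, hpd⟩ := BoolFn.exists_approximates_totalDegree_eq_adeg
    (BoolFn.comp f (BoolFn.comp (BoolFn.AND t) (BoolFn.OR m)))
  obtain ⟨q, hqd, hq⟩ := BoolFn.exists_average_polynomial (ι := Fin n)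
    (hmom.blockWeight (ι := Fin t)) p
  have happ := BoolFn.approximates_of_average
    (fun a => BoolFn.blockWeight_mem_stdSimplex fun _ => hν a)
    (BoolFn.sum_blockWeight_AND_OR_le hν h1 h0) hp hq
  -- Half of the exponent absorbs the factor `n ≤ exp t`, the other half gives the constant.
  have hn : (n : ℝ) * (1 / 10000) ^ t ≤ 1 / 100 := by
    have h2 : (n : ℝ) ≤ 100 ^ t := by
      rcases Nat.eq_zero_or_pos n with rfl | hn
      · simp
      · calc (n : ℝ) ≤ Real.exp t := by
              rw [← Real.log_le_iff_le_exp (by exact_mod_cast hn)]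
              linarith
          _ = Real.exp 1 ^ t := by rw [← Real.exp_nat_mul, mul_one]
          _ ≤ 100 ^ t := pow_le_pow_left₀ (Real.exp_pos 1).le
              (Real.exp_one_lt_d9.le.trans (by norm_num)) t
    calc (n : ℝ) * (1 / 10000) ^ t ≤ 100 ^ t * (1 / 10000) ^ t := by gcongr
      _ = (1 / 100) ^ t := by rw [← mul_pow]; norm_num
      _ ≤ (1 / 100) ^ 1 := pow_le_pow_of_le_one (by norm_num) (by norm_num) ht
      _ = 1 / 100 := pow_one _
  have hf : BoolFn.adeg f ≤ 3 * q.totalDegree := by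
    refine BoolFn.adeg_le_three_mul_of_approximates fun b => (happ b).trans ?_
    rw [Fintype.card_fin]
    linarith
  rw [← hpd, div_mul_eq_mul_div, one_mul, div_le_iff₀ (by positivity)]
  have hmain : BoolFn.adeg f * A ≤ p.totalDegree * (3 * k) :=
    calc BoolFn.adeg f * A ≤ (3 * q.totalDegree) * (k * (e + 1)) := Nat.mul_le_mul hf he2
      _ = q.totalDegree * (e + 1) * (3 * k) := by ring
      _ ≤ p.totalDegree * (3 * k) := Nat.mul_le_mul_right _ hqd
  exact_mod_cast hmain
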